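/- Let $d\ge 2$, let $\Omega\subset\mathbb{R}^d$ be compact and convex, and let $\mu,\nu$ be Borel probability measures concentrated on $\Omega$. Put $$W_1(\mu,\nu)=\inf_{T_\#\mu=\nu}\int_\Omega |x-T(x)|\,d\mu(x),$$ the infimum being over Borel maps $T$ that push $\mu$ forward to $\nu$; a map attaining it is called an optimal transport map. A Kantorovich potential is a function $u_0$ that is $1$-Lipschitz on $\Omega$ and maximizes $\int_\Omega u\,d\mu-\int_\Omega u\,d\nu$ among all functions $u$ that are $1$-Lipschitz on $\Omega$. Assume that $\mu$ is absolutely continuous with respect to Lebesgue measure and that the support of $\nu$ (the smallest closed set of full $\nu$-measure) is contained in an (embedded) $C^1$ submanifold $M$ of $\mathbb{R}^d$ with $\dim M\le d-2$. Then an optimal transport map $T_0$ for $W_1(\mu,\nu)$ exists and is unique up to modification on sets of $\mu$-measure zero. Kantorovich potentials exist, and for every Kantorovich potential $u_0$ and every optimal transport map $T_0$, for $\mu$-almost every $x$ the function $u_0$ is differentiable at $x$ and $$T_0(x)=x-\alpha(x)\nabla u_0(x),\qquad \alpha(x)=\sup\{|x-z| : z\in\Omega,\ u_0(x)-u_0(z)=|x-z|\}.$$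 -/

import Mathlib

open MeasureTheory
open scoped ENNReal Gradient

noncomputable section

/-- `M` is an (embedded) `C¹` submanifold of `ℝ^d` of dimension `m`: around each of its points there
is a `C¹` diffeomorphism between open subsets of `ℝ^d` that straightens `M` to the coordinate plane
`ℝ^m × {0}`, on which all coordinates but the first `m` vanish. -/
def IsC1Submanifold {d : ℕ} (m : ℕ) (M : Set (EuclideanSpace ℝ (Fin d))) : Prop :=
  m ≤ d ∧ ∀ p ∈ M,
    ∃ e : OpenPartialHomeomorph (EuclideanSpace ℝ (Fin d)) (EuclideanSpace ℝ (Fin d)),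
      p ∈ e.source ∧ ContDiffOn ℝ 1 e e.source ∧ ContDiffOn ℝ 1 e.symm e.target ∧
        ∀ x ∈ e.source, x ∈ M ↔ ∀ i : Fin d, m ≤ (i : ℕ) → e x i = 0

/-- The cost `∫_Ω |x - T(x)| dμ(x)` of a map `T`. -/
def transportCost {d : ℕ} (Ω : Set (EuclideanSpace ℝ (Fin d)))
    (μ : Measure (EuclideanSpace ℝ (Fin d)))
    (T : EuclideanSpace ℝ (Fin d) → EuclideanSpace ℝ (Fin d)) : ℝ≥0∞ :=
  ∫⁻ x in Ω, ENNReal.ofReal ‖x - T x‖ ∂μ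

/-- `W₁(μ, ν)`, the infimum of the cost over the Borel maps `T` with `T_# μ = ν`. -/
def W1 {d : ℕ} (Ω : Set (EuclideanSpace ℝ (Fin d)))
    (μ ν : Measure (EuclideanSpace ℝ (Fin d))) : ℝ≥0∞ :=
  ⨅ (T : EuclideanSpace ℝ (Fin d) → EuclideanSpace ℝ (Fin d)) (_ : MeasurePreserving T μ ν),
    transportCost Ω μ T

/-- `T` is an optimal transport map for `W₁(μ, ν)`: it is Borel, pushes `μ` forward to `ν`, and
attains the infimum that defines `W₁(μ, ν)`. -/
def IsOptimalTransportMap {d : ℕ} (Ω : Set (EuclideanSpace ℝ (Fin d)))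
    (μ ν : Measure (EuclideanSpace ℝ (Fin d)))
    (T : EuclideanSpace ℝ (Fin d) → EuclideanSpace ℝ (Fin d)) : Prop :=
  MeasurePreserving T μ ν ∧ transportCost Ω μ T = W1 Ω μ ν

/-- `u` is a Kantorovich potential for `W₁(μ, ν)`: it is `1`-Lipschitz on `Ω` and maximizes
`∫_Ω u dμ - ∫_Ω u dν` among all such functions. Its values outside `Ω` are irrelevant. -/
def IsKantorovichPotential {d : ℕ} (Ω : Set (EuclideanSpace ℝ (Fin d)))
    (μ ν : Measure (EuclideanSpace ℝ (Fin d))) (u : EuclideanSpace ℝ (Fin d) → ℝ) : Prop :=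
  LipschitzOnWith 1 u Ω ∧
    ∀ v : EuclideanSpace ℝ (Fin d) → ℝ, LipschitzOnWith 1 v Ω →
      (∫ x in Ω, v x ∂μ) - ∫ y in Ω, v y ∂ν ≤ (∫ x in Ω, u x ∂μ) - ∫ y in Ω, u y ∂ν

/-- `α(x) = sup {|x - z| : z ∈ Ω, u(x) - u(z) = |x - z|}`. -/
def rayLength {d : ℕ} (Ω : Set (EuclideanSpace ℝ (Fin d))) (u : EuclideanSpace ℝ (Fin d) → ℝ)
    (x : EuclideanSpace ℝ (Fin d)) : ℝ :=
  sSup {r : ℝ | ∃ z ∈ Ω, u x - u z = ‖x - z‖ ∧ r = ‖x - z‖}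

end

open Set Filter Topology

/-! Duality gives a potential `u` and a coupling whose cost equals the dual value of `u`; such a
coupling is carried by pairs with `u x - u y = ‖x - y‖`. Where `u` is differentiable, `y` must lie
on the ray from `x` in direction `-∇ u x`, so only its distance is free. By
`LipschitzOnWith.ae_eq_ray_end`, `y` is almost surely the lower end of the ray: otherwise `y ∈ M` is
interior to a ray, and ray directions are Lipschitz at points a fixed distance away from both ends
(`LipschitzOnWith.norm_direction_sub_le`). The lines through such points of `M` sweep out a set of
dimension at most `m + 1 < d`, hence a null set.

So every optimal coupling is the graph of one explicit map. This yields a map attaining the dual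
value, and uniqueness. Potentials come from Arzelà–Ascoli, the coupling from Hahn–Banach and
Riesz–Markov. -/

/-! ### Lines through a submanifold of codimension at least two -/

theorem volume_eq_zero_of_dimH_lt {d : ℕ} {s : Set (EuclideanSpace ℝ (Fin d))}
    (h : dimH s < d) : volume s = 0 := by
  have h1 : (volume : Measure (EuclideanSpace ℝ (Fin d))) ≪ μH[((d : NNReal) : ℝ)] := by
    have := isAddHaarMeasure_hausdorffMeasure (E := EuclideanSpace ℝ (Fin d))
    rw [finrank_euclideanSpace_fin] at this
    have : Measure.IsAddHaarMeasure (G := EuclideanSpace ℝ (Fin d)) μH[((d : NNReal) : ℝ)] := this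
    exact Measure.absolutelyContinuous_isAddHaarMeasure _ _
  exact measure_zero_of_dimH_lt h1 (by exact_mod_cast h)

/-- The inclusion of `ℝ^m` in `ℝ^d` as the first coordinates. -/
noncomputable def coordInclusion (m d : ℕ) : (Fin m → ℝ) →L[ℝ] EuclideanSpace ℝ (Fin d) :=
  LinearMap.toContinuousLinearMap
    { toFun := fun w => WithLp.toLp 2 fun i => if h : (i : ℕ) < m then w ⟨i, h⟩ else 0
      map_add' := by intro x y; ext i; by_cases h : (i : ℕ) < m <;> simp [h]
      map_smul' := by intro c x; ext i; by_cases h : (i : ℕ) < m <;> simp [h] }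

theorem exists_coordInclusion_eq {m d : ℕ} (hmd : m ≤ d) (z : EuclideanSpace ℝ (Fin d))
    (hz : ∀ i : Fin d, m ≤ (i : ℕ) → z i = 0) : ∃ w, coordInclusion m d w = z := by
  refine ⟨fun i => z (Fin.castLE hmd i), ?_⟩
  ext i
  by_cases h : (i : ℕ) < m
  · simp [coordInclusion, h]
  · simp [coordInclusion, h, hz i (not_lt.1 h)]

/-- The parametrisation is locally Lipschitz on a subset of an `(m + 1)`-dimensional space, and such
maps do not raise Hausdorff dimension. -/
theorem dimH_image_ruled_le {m : ℕ} {E : Type*} [NormedAddCommGroup E] [NormedSpace ℝ E]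
    {φ : (Fin m → ℝ) → E} {V : Set (Fin m → ℝ)} (hφ : ∀ w ∈ V, ContDiffAt ℝ 1 φ w)
    {A : Set E} {K : NNReal} {e : E → E} (he : LipschitzOnWith K e A) (he1 : ∀ y ∈ A, ‖e y‖ ≤ 1) :
    dimH ((fun q : (Fin m → ℝ) × ℝ => φ q.1 + q.2 • e (φ q.1)) ''
      {q | q.1 ∈ V ∧ φ q.1 ∈ A}) ≤ (m + 1 : ℕ) := by
  set S : Set ((Fin m → ℝ) × ℝ) := {q | q.1 ∈ V ∧ φ q.1 ∈ A}
  have key : ∀ q ∈ S, ∃ C : NNReal, ∃ t ∈ 𝓝[S] q,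
      LipschitzOnWith C (fun q : (Fin m → ℝ) × ℝ => φ q.1 + q.2 • e (φ q.1)) t := by
    rintro ⟨w, t⟩ ⟨hw, hwA⟩
    obtain ⟨C, U, hU, hC⟩ := (hφ w hw).exists_lipschitzOnWith
    -- `R` bounds the line parameter near `t`; it multiplies the variation of `e`, so the Lipschitz
    -- constant is only local.
    let R : NNReal := ⟨|t| + 1, by positivity⟩
    refine ⟨C + (R * (K * C) + 1), S ∩ (U ×ˢ Metric.ball t 1), ?_, ?_⟩
    · exact inter_mem self_mem_nhdsWithin (mem_nhdsWithin_of_mem_nhds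
        (prod_mem_nhds hU (Metric.ball_mem_nhds t one_pos)))
    · refine LipschitzOnWith.of_dist_le_mul ?_
      rintro ⟨w₁, t₁⟩ ⟨⟨-, h1A⟩, h1U, h1t⟩ ⟨w₂, t₂⟩ ⟨⟨-, h2A⟩, h2U, h2t⟩
      have hd1 : dist w₁ w₂ ≤ dist (w₁, t₁) (w₂, t₂) := le_max_left _ _
      have hd2 : ‖t₁ - t₂‖ ≤ dist (w₁, t₁) (w₂, t₂) := by
        rw [← dist_eq_norm]; exact le_max_right _ _
      set D := dist (w₁, t₁) (w₂, t₂)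
      have hl : ‖φ w₁ - φ w₂‖ ≤ C * D := by
        rw [← dist_eq_norm]
        exact (hC.dist_le_mul _ h1U _ h2U).trans (by gcongr)
      have hl2 : ‖e (φ w₁) - e (φ w₂)‖ ≤ K * (C * D) := by
        have := he.dist_le_mul _ h1A _ h2A
        rw [dist_eq_norm, dist_eq_norm] at this
        exact this.trans (by gcongr)
      have ht1 : ‖t₁‖ ≤ R := by
        have h3 : |t₁ - t| < 1 := by simpa [Real.dist_eq] using h1t
        have h4 := abs_sub_abs_le_abs_sub t₁ t
        change |t₁| ≤ |t| + 1
        linarith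
      have hsplit : (φ w₁ + t₁ • e (φ w₁)) - (φ w₂ + t₂ • e (φ w₂)) =
          (φ w₁ - φ w₂) + (t₁ • (e (φ w₁) - e (φ w₂)) + (t₁ - t₂) • e (φ w₂)) := by
        module
      change dist (φ w₁ + t₁ • e (φ w₁)) (φ w₂ + t₂ • e (φ w₂)) ≤ _
      rw [dist_eq_norm, hsplit]
      calc _ ≤ ‖φ w₁ - φ w₂‖ + (‖t₁ • (e (φ w₁) - e (φ w₂))‖ + ‖(t₁ - t₂) • e (φ w₂)‖) :=
            (norm_add_le _ _).trans (by gcongr; exact norm_add_le _ _)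
        _ ≤ C * D + (R * (K * (C * D)) + D * 1) := by
            rw [norm_smul, norm_smul]
            gcongr
            exact he1 _ h2A
        _ = _ := by push_cast; ring
  refine (dimH_image_le_of_locally_lipschitzOn key).trans ((dimH_mono (subset_univ S)).trans ?_)
  rw [Real.dimH_univ_eq_finrank]
  simp

/-- By the Lindelöf property countably many charts cover `M`, and each contributes a set of
dimension at most `m + 1 < d`. -/
theorem IsC1Submanifold.volume_ruled_eq_zero {d m : ℕ} (hm : m + 2 ≤ d)
    {M : Set (EuclideanSpace ℝ (Fin d))} (hM : IsC1Submanifold m M)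
    {A : Set (EuclideanSpace ℝ (Fin d))} {K : NNReal}
    {e : EuclideanSpace ℝ (Fin d) → EuclideanSpace ℝ (Fin d)}
    (he : LipschitzOnWith K e A) (he1 : ∀ y ∈ A, ‖e y‖ ≤ 1) :
    volume {x | ∃ y ∈ M ∩ A, ∃ t : ℝ, x = y + t • e y} = 0 := by
  have : Nonempty (OpenPartialHomeomorph (EuclideanSpace ℝ (Fin d)) (EuclideanSpace ℝ (Fin d))) :=
    ⟨OpenPartialHomeomorph.refl _⟩
  choose! χ hχ using hM.2
  obtain ⟨c, hcM, hc, hcover⟩ := TopologicalSpace.countable_cover_nhdsWithin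
    (f := fun p => (χ p).source) (s := M) fun p hp =>
      mem_nhdsWithin_of_mem_nhds ((χ p).open_source.mem_nhds (hχ p hp).1)
  have hsub : {x | ∃ y ∈ M ∩ A, ∃ t : ℝ, x = y + t • e y} ⊆
      ⋃ p ∈ c, (fun q : (Fin m → ℝ) × ℝ => (χ p).symm (coordInclusion m d q.1) +
        q.2 • e ((χ p).symm (coordInclusion m d q.1))) ''
        {q | q.1 ∈ coordInclusion m d ⁻¹' (χ p).target ∧
          (χ p).symm (coordInclusion m d q.1) ∈ A} := by
    rintro x ⟨y, ⟨hyM, hyA⟩, t, rfl⟩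
    obtain ⟨p, hp, hyp⟩ := mem_iUnion₂.1 (hcover hyM)
    obtain ⟨w, hw⟩ := exists_coordInclusion_eq hM.1 (χ p y)
      (((hχ p (hcM hp)).2.2.2 y hyp).1 hyM)
    have hinv : (χ p).symm (coordInclusion m d w) = y := by rw [hw, (χ p).left_inv hyp]
    refine mem_iUnion₂.2 ⟨p, hp, (w, t), ⟨?_, ?_⟩, ?_⟩
    · simpa [hw] using (χ p).map_source hyp
    · simpa [hinv] using hyA
    · simp [hinv]
  refine measure_mono_null hsub ((measure_biUnion_null_iff hc).2 fun p hp => ?_)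
  refine volume_eq_zero_of_dimH_lt ((dimH_image_ruled_le
    (φ := fun w => (χ p).symm (coordInclusion m d w)) ?_ he he1).trans_lt
      (by exact_mod_cast (by omega : m + 1 < d)))
  intro w hw
  exact ((hχ p (hcM hp)).2.2.1.contDiffAt ((χ p).open_target.mem_nhds hw)).comp w
    (coordInclusion m d).contDiff.contDiffAt

theorem IsC1Submanifold.volume_eq_zero {d m : ℕ} (hm : m + 2 ≤ d)
    {M : Set (EuclideanSpace ℝ (Fin d))} (hM : IsC1Submanifold m M) : volume M = 0 := by
  -- With the zero direction field the ruled set is `M` itself.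
  refine measure_mono_null ?_ (hM.volume_ruled_eq_zero hm (A := univ) (e := fun _ => 0) (K := 0)
    (LipschitzWith.const 0).lipschitzOnWith (by simp))
  exact fun y hy => ⟨y, ⟨hy, mem_univ y⟩, 0, by simp⟩

/-! ### Geometry of transport rays -/

section Rays

variable {E : Type*} [NormedAddCommGroup E] {Ω : Set E} {u : E → ℝ}

theorem LipschitzOnWith.sub_le_norm_sub (hu : LipschitzOnWith 1 u Ω) {x y : E} (hx : x ∈ Ω)
    (hy : y ∈ Ω) : u x - u y ≤ ‖x - y‖ := by
  have := hu.dist_le_mul x hx y hy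
  rw [Real.dist_eq, dist_eq_norm, NNReal.coe_one, one_mul] at this
  exact (le_abs_self _).trans this

/-- The two Lipschitz bounds add up to the total drop of `u`, so neither can be strict. -/
theorem LipschitzOnWith.eq_of_between (hu : LipschitzOnWith 1 u Ω) {x y z : E} (hx : x ∈ Ω)
    (hy : y ∈ Ω) (hz : z ∈ Ω) (hxz : u x - u z = ‖x - z‖) (hb : ‖x - y‖ + ‖y - z‖ = ‖x - z‖) :
    u x - u y = ‖x - y‖ ∧ u y - u z = ‖y - z‖ := by
  have h1 := hu.sub_le_norm_sub hx hy
  have h2 := hu.sub_le_norm_sub hy hz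
  constructor <;> linarith

/-- Directions of transport rays depend in a Lipschitz way on the points that lie inside the rays
at distance at least `ε` from both ends. -/
theorem LipschitzOnWith.norm_direction_sub_le [InnerProductSpace ℝ E]
    (hu : LipschitzOnWith 1 u Ω) {ε : ℝ} (hε : 0 < ε)
    {y e y' e' : E} (hy : y ∈ Ω) (hy' : y' ∈ Ω) (he : ‖e‖ = 1) (he' : ‖e'‖ = 1)
    (hp : y + ε • e ∈ Ω) (hn : y - ε • e ∈ Ω) (hp' : y' + ε • e' ∈ Ω) (hn' : y' - ε • e' ∈ Ω)
    (up : u (y + ε • e) = u y + ε) (un : u (y - ε • e) = u y - ε)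
    (up' : u (y' + ε • e') = u y' + ε) (un' : u (y' - ε • e') = u y' - ε) :
    ‖e - e'‖ ≤ ε⁻¹ * ‖y - y'‖ := by
  rw [← div_eq_inv_mul, le_div_iff₀ hε]
  -- Comparing the upper point of each ray with the lower point of the other bounds `2ε ± (u y - u
  -- y')`. Squaring, adding and using the parallelogram law twice gives the estimate.
  have h1 := hu.sub_le_norm_sub hp hn'
  have h2 := hu.sub_le_norm_sub hp' hn
  have h3 := hu.sub_le_norm_sub hy hy'
  have h4 := hu.sub_le_norm_sub hy' hy
  rw [norm_sub_rev y' y] at h4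
  rw [show y + ε • e - (y' - ε • e') = (y - y') + ε • (e + e') by module, up, un'] at h1
  rw [show y' + ε • e' - (y - ε • e) = -((y - y') - ε • (e + e')) by module, norm_neg, up', un]
    at h2
  -- For distant points `‖e - e'‖ ≤ 2` suffices; for near ones `2ε ± (u y - u y')` is nonnegative
  -- and may be squared.
  rcases le_or_gt (2 * ε) ‖y - y'‖ with h | h
  · have : ‖e - e'‖ ≤ 2 := (_root_.norm_sub_le _ _).trans (by rw [he, he']; norm_num)
    nlinarith
  · have p1 := parallelogram_law_with_norm ℝ (y - y') (ε • (e + e'))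
    have p2 := parallelogram_law_with_norm ℝ e e'
    rw [norm_smul, Real.norm_of_nonneg hε.le] at p1
    rw [he, he'] at p2
    set a := u y - u y' with ha
    have q1 : (2 * ε + a) ^ 2 ≤ ‖y - y' + ε • (e + e')‖ ^ 2 :=
      pow_le_pow_left₀ (by linarith) (by linarith) 2
    have q2 : (2 * ε - a) ^ 2 ≤ ‖y - y' - ε • (e + e')‖ ^ 2 :=
      pow_le_pow_left₀ (by linarith) (by linarith) 2
    refine le_of_sq_le_sq ?_ (norm_nonneg _)
    have p3 : ε ^ 2 * (‖e + e'‖ ^ 2 + ‖e - e'‖ ^ 2) = ε ^ 2 * 4 := by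
      rw [p2]; norm_num
    nlinarith [sq_nonneg a]

variable [InnerProductSpace ℝ E]

/-- The derivative of `u` towards `z` is `-‖x - z‖` while `‖∇ u x‖ ≤ 1`: this is the equality case
of Cauchy–Schwarz. -/
theorem LipschitzOnWith.sub_eq_norm_smul_gradient [CompleteSpace E] (hΩ : Convex ℝ Ω)
    (hu : LipschitzOnWith 1 u Ω)
    {x z : E} (hx : x ∈ interior Ω) (hdx : DifferentiableAt ℝ u x) (hz : z ∈ Ω)
    (hxz : u x - u z = ‖x - z‖) : x - z = ‖x - z‖ • ∇ u x := by
  have hxΩ := interior_subset hx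
  have hder : HasDerivWithinAt (fun t : ℝ => u (x + t • (z - x))) (fderiv ℝ u x (z - x))
      (Icc 0 1) 0 := by
    have h1 : HasDerivAt (fun t : ℝ => x + t • (z - x)) (z - x) 0 := by
      simpa using ((hasDerivAt_id (0 : ℝ)).smul_const (z - x)).const_add x
    have h2 : HasFDerivAt u (fderiv ℝ u x) (x + (0 : ℝ) • (z - x)) := by
      simpa using hdx.hasFDerivAt
    exact (h2.comp_hasDerivAt (0 : ℝ) h1).hasDerivWithinAt
  -- `u` is known to be affine only on the segment, hence the one-sided derivative.
  have hder2 : HasDerivWithinAt (fun t : ℝ => u (x + t • (z - x))) (-‖x - z‖) (Icc 0 1) 0 := by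
    have h1 : HasDerivWithinAt (fun t : ℝ => u x - t * ‖x - z‖) (-‖x - z‖) (Icc 0 1) 0 := by
      simpa using (((hasDerivAt_id (0 : ℝ)).mul_const ‖x - z‖).const_sub (u x)).hasDerivWithinAt
    refine h1.congr_of_mem (fun t ht => ?_) (by simp)
    have hmem : x + t • (z - x) ∈ Ω := hΩ.add_smul_sub_mem hxΩ hz ht
    have e1 : ‖x - (x + t • (z - x))‖ = t * ‖x - z‖ := by
      rw [show x - (x + t • (z - x)) = t • (x - z) by module, norm_smul,
        Real.norm_of_nonneg ht.1]
    have e2 : ‖x + t • (z - x) - z‖ = (1 - t) * ‖x - z‖ := by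
      rw [show x + t • (z - x) - z = (1 - t) • (x - z) by module, norm_smul,
        Real.norm_of_nonneg (by linarith [ht.2])]
    have := (hu.eq_of_between hxΩ hmem hz hxz (by rw [e1, e2]; ring)).1
    rw [e1] at this
    linarith
  have heq : fderiv ℝ u x (z - x) = -‖x - z‖ :=
    (uniqueDiffOn_Icc one_pos 0 (by simp)).eq_deriv _ hder hder2
  have hin : inner ℝ (∇ u x) (x - z) = ‖x - z‖ := by
    rw [gradient, InnerProductSpace.toDual_symm_apply, ← neg_sub z x, map_neg, heq]
    simp
  have hg : ‖∇ u x‖ ≤ 1 := by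
    rw [gradient, LinearIsometryEquiv.norm_map]
    simpa using norm_fderiv_le_of_lipschitzOn ℝ (mem_interior_iff_mem_nhds.1 hx) hu
  have hsq : ‖(x - z) - ‖x - z‖ • ∇ u x‖ ^ 2 ≤ 0 := by
    rw [norm_sub_sq_real, inner_smul_right, real_inner_comm, hin, norm_smul, norm_norm]
    have : ‖∇ u x‖ ^ 2 ≤ 1 := pow_le_one₀ (norm_nonneg _) hg
    nlinarith [sq_nonneg ‖x - z‖]
  have : ‖(x - z) - ‖x - z‖ • ∇ u x‖ = 0 := by
    nlinarith [norm_nonneg ((x - z) - ‖x - z‖ • ∇ u x)]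
  exact sub_eq_zero.1 (norm_eq_zero.1 this)

variable (Ω u) in
/-- The points at distance at least `ε` from both ends of a transport ray of direction `e`. -/
def IsInnerRayPoint (ε : ℝ) (y e : E) : Prop :=
  y ∈ Ω ∧ ‖e‖ = 1 ∧ y + ε • e ∈ Ω ∧ y - ε • e ∈ Ω ∧ u (y + ε • e) = u y + ε ∧
    u (y - ε • e) = u y - ε

/-- `u` falls with slope one along the whole segment from `x` to `x - a • e`; here `s` is the
distance from `x`. -/
theorem LipschitzOnWith.isInnerRayPoint (hΩ : Convex ℝ Ω) (hu : LipschitzOnWith 1 u Ω)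
    {x e : E} {a s ε : ℝ} (he : ‖e‖ = 1) (hx : x ∈ Ω) (hz : x - a • e ∈ Ω)
    (hxz : u x - u (x - a • e) = a) (hε : 0 ≤ ε) (hs : ε ≤ s) (has : ε ≤ a - s) :
    IsInnerRayPoint Ω u ε (x - s • e) e := by
  have ha : 0 ≤ a := by linarith
  have key : ∀ t ∈ Icc 0 a, x - t • e ∈ Ω ∧ u (x - t • e) = u x - t := by
    rintro t ⟨ht0, hta⟩
    have hmem : x - t • e ∈ Ω := by
      rcases ha.eq_or_lt with h | h
      · have : t = 0 := by linarith
        simpa [this] using hx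
      · have := hΩ.add_smul_sub_mem hx hz (t := t / a) ⟨by positivity, div_le_one_of_le₀ hta ha⟩
        convert this using 1
        rw [show x - a • e - x = -(a • e) by abel, smul_neg, smul_smul, div_mul_cancel₀ _ h.ne']
        abel
    refine ⟨hmem, ?_⟩
    have e1 : ‖x - (x - t • e)‖ = t := by
      rw [sub_sub_cancel, norm_smul, he, Real.norm_of_nonneg ht0, mul_one]
    have e2 : ‖x - (x - a • e)‖ = a := by
      rw [sub_sub_cancel, norm_smul, he, Real.norm_of_nonneg ha, mul_one]
    have e3 : ‖x - t • e - (x - a • e)‖ = a - t := by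
      rw [show x - t • e - (x - a • e) = (a - t) • e by module, norm_smul, he,
        Real.norm_of_nonneg (by linarith), mul_one]
    have := (hu.eq_of_between hx hmem hz (by rw [hxz, e2]) (by rw [e1, e2, e3]; ring)).1
    rw [e1] at this
    linarith
  have k0 := key s ⟨by linarith, by linarith⟩
  have k1 := key (s - ε) ⟨by linarith, by linarith⟩
  have k2 := key (s + ε) ⟨by linarith, by linarith⟩
  have r1 : x - s • e + ε • e = x - (s - ε) • e := by module
  have r2 : x - s • e - ε • e = x - (s + ε) • e := by module
  refine ⟨k0.1, he, ?_, ?_, ?_, ?_⟩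
  · rw [r1]; exact k1.1
  · rw [r2]; exact k2.1
  · rw [r1, k1.2, k0.2]; ring
  · rw [r2, k2.2, k0.2]; ring

end Rays

/-! ### Targets in `M` are lower ends of rays -/

/-- The set of admissible `z` is compact and contains `x`, so the supremum is attained and `sSup`
takes no default value. -/
theorem exists_rayLength_eq {d : ℕ} {Ω : Set (EuclideanSpace ℝ (Fin d))} (hΩ : IsCompact Ω)
    {u : EuclideanSpace ℝ (Fin d) → ℝ} (hu : LipschitzOnWith 1 u Ω)
    {x : EuclideanSpace ℝ (Fin d)} (hx : x ∈ Ω) :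
    (∃ z ∈ Ω, u x - u z = ‖x - z‖ ∧ rayLength Ω u x = ‖x - z‖) ∧
      ∀ y ∈ Ω, u x - u y = ‖x - y‖ → ‖x - y‖ ≤ rayLength Ω u x := by
  have hcomp : IsCompact {z ∈ Ω | u x - u z = ‖x - z‖} := by
    have hc : ContinuousOn (fun z => u x - u z - ‖x - z‖) Ω :=
      (continuousOn_const.sub hu.continuousOn).sub (by fun_prop)
    have := hc.preimage_isClosed_of_isClosed hΩ.isClosed (isClosed_singleton (x := (0 : ℝ)))
    convert hΩ.of_isClosed_subset this inter_subset_left using 1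
    ext z
    simp [sub_eq_zero]
  have himg : {r : ℝ | ∃ z ∈ Ω, u x - u z = ‖x - z‖ ∧ r = ‖x - z‖} =
      (fun z => ‖x - z‖) '' {z ∈ Ω | u x - u z = ‖x - z‖} := by
    ext r
    constructor
    · rintro ⟨z, h1, h2, rfl⟩
      exact ⟨z, ⟨h1, h2⟩, rfl⟩
    · rintro ⟨z, ⟨h1, h2⟩, rfl⟩
      exact ⟨z, h1, h2, rfl⟩
  have hc2 := hcomp.image (f := fun z => ‖x - z‖) (by fun_prop)
  rw [rayLength, himg]
  constructor
  · obtain ⟨z, ⟨h1, h2⟩, h3⟩ := hc2.sSup_mem (Set.Nonempty.image _ ⟨x, hx, by simp⟩)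
    exact ⟨z, h1, h2, h3.symm⟩
  · exact fun y hy h => le_csSup hc2.bddAbove ⟨y, ⟨hy, h⟩, rfl⟩

theorem LipschitzOnWith.ae_eq_ray_end {d m : ℕ} (hm : m + 2 ≤ d)
    {Ω : Set (EuclideanSpace ℝ (Fin d))} (hΩ : IsCompact Ω) (hΩ' : Convex ℝ Ω)
    {M : Set (EuclideanSpace ℝ (Fin d))} (hM : IsC1Submanifold m M)
    {u : EuclideanSpace ℝ (Fin d) → ℝ} (hu : LipschitzOnWith 1 u Ω) :
    ∀ᵐ x, x ∈ Ω → DifferentiableAt ℝ u x ∧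
      ∀ y ∈ Ω ∩ M, u x - u y = ‖x - y‖ → y = x - rayLength Ω u x • ∇ u x := by
  -- Every interior point of a ray lies in some `A n`, so countably many null sets cover all
  -- exceptional `x`.
  let A : ℕ → Set (EuclideanSpace ℝ (Fin d)) :=
    fun n => {y | ∃ e, IsInnerRayPoint Ω u (1 / ((n : ℝ) + 1)) y e}
  have hdir : ∀ n : ℕ, ∃ e : EuclideanSpace ℝ (Fin d) → EuclideanSpace ℝ (Fin d),
      ∀ y ∈ A n, IsInnerRayPoint Ω u (1 / ((n : ℝ) + 1)) y (e y) := by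
    intro n
    classical
    exact ⟨fun y => if h : y ∈ A n then h.choose else 0, fun y hy => by
      simp only [hy, dite_true]; exact Exists.choose_spec hy⟩
  choose e he using hdir
  have hpos : ∀ n : ℕ, 0 < 1 / ((n : ℝ) + 1) := fun n => Nat.one_div_pos_of_nat
  have hdirlip : ∀ n : ℕ, ∀ y y' v v', IsInnerRayPoint Ω u (1 / ((n : ℝ) + 1)) y v →
      IsInnerRayPoint Ω u (1 / ((n : ℝ) + 1)) y' v' →
      ‖v - v'‖ ≤ (1 / ((n : ℝ) + 1))⁻¹ * ‖y - y'‖ := by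
    rintro n y y' v v' ⟨a1, a2, a3, a4, a5, a6⟩ ⟨b1, b2, b3, b4, b5, b6⟩
    exact hu.norm_direction_sub_le (hpos n) a1 b1 a2 b2 a3 a4 b3 b4 a5 a6 b5 b6
  have hnull : ∀ n : ℕ, ∀ᵐ x, x ∉ {x | ∃ y ∈ M ∩ A n, ∃ t : ℝ, x = y + t • e n y} := by
    intro n
    refine measure_eq_zero_iff_ae_notMem.1 (hM.volume_ruled_eq_zero hm
      (K := ⟨(1 / ((n : ℝ) + 1))⁻¹, by positivity⟩) ?_ fun y hy => (he n y hy).2.1.le)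
    refine LipschitzOnWith.of_dist_le_mul fun y hy y' hy' => ?_
    rw [dist_eq_norm, dist_eq_norm]
    exact hdirlip n y y' _ _ (he n y hy) (he n y' hy')
  have hfr : ∀ᵐ x, x ∉ frontier Ω := measure_eq_zero_iff_ae_notMem.1 (hΩ'.addHaar_frontier _)
  have hMn : ∀ᵐ x, x ∉ M := measure_eq_zero_iff_ae_notMem.1 (hM.volume_eq_zero hm)
  filter_upwards [hu.ae_differentiableWithinAt_of_mem (μ := volume), hfr, hMn,
    ae_all_iff.2 hnull] with x hxd hxf hxM hxn hxΩ
  have hxi : x ∈ interior Ω := by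
    by_contra h
    exact hxf ⟨subset_closure hxΩ, h⟩
  have hd : DifferentiableAt ℝ u x :=
    (hxd hxΩ).differentiableAt (mem_interior_iff_mem_nhds.1 hxi)
  refine ⟨hd, ?_⟩
  rintro y ⟨hyΩ, hyM⟩ hxy
  obtain ⟨⟨z, hz, hxz, hrz⟩, hmax⟩ := exists_rayLength_eq hΩ hu hxΩ
  have h1 := hu.sub_eq_norm_smul_gradient hΩ' hxi hd hz hxz
  have h2 := hu.sub_eq_norm_smul_gradient hΩ' hxi hd hyΩ hxy
  have hy_eq : y = x - ‖x - y‖ • ∇ u x := by rw [← h2]; abel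
  -- As `M` is null, `x ∉ M`; hence `y` is not the upper end of the segment.
  have hyx : 0 < ‖x - y‖ := by
    rw [norm_pos_iff, sub_ne_zero]
    rintro rfl
    exact hxM hyM
  have hg : ‖∇ u x‖ = 1 := by
    have := congrArg norm h2
    rw [norm_smul, norm_norm] at this
    exact mul_left_cancel₀ hyx.ne' (by rw [mul_one]; exact this.symm)
  rcases (hmax y hyΩ hxy).eq_or_lt with heq | hlt
  · rw [← heq]; exact hy_eq
  · exfalso
    rw [hrz] at hlt
    -- If `y` comes strictly before the lower end `z`, it is interior at some scale `1 / (n + 1)`,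
    -- and `x` lies on the exceptional line through `y`.
    obtain ⟨n, hn⟩ := exists_nat_one_div_lt (lt_min hyx (sub_pos.2 hlt))
    have hz_eq : x - ‖x - z‖ • ∇ u x = z := by rw [← h1]; abel
    have hin : IsInnerRayPoint Ω u (1 / ((n : ℝ) + 1)) y (∇ u x) := by
      have := hu.isInnerRayPoint hΩ' (a := ‖x - z‖) (s := ‖x - y‖) (x := x) hg hxΩ
        (by rw [hz_eq]; exact hz) (by rw [hz_eq]; exact hxz) (hpos n).le
        (hn.le.trans (min_le_left _ _)) (hn.le.trans (min_le_right _ _))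
      rwa [← hy_eq] at this
    have hyA : y ∈ A n := ⟨_, hin⟩
    -- The Lipschitz bound at coinciding base points shows that the ray direction is unique.
    have hev : e n y = ∇ u x := by
      have := hdirlip n y y _ _ (he n y hyA) hin
      rw [sub_self, norm_zero, mul_zero] at this
      exact sub_eq_zero.1 (norm_le_zero_iff.1 this)
    exact hxn n ⟨y, ⟨hyM, hyA⟩, ‖x - y‖, by rw [hev, ← h2]; abel⟩

/-! ### Kantorovich–Rubinstein duality on a compact metric space -/

section Duality

open CompactlySupported BoundedContinuousFunction

variable {X : Type*} [MetricSpace X] [MeasurableSpace X]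

/-- `r` is an upper bound for the integral of `F` obtained from a majorant of the form
`f(x) + g(y) + t |x - y|`. -/
def IsMajorantBound (μ ν : Measure X) (K : ℝ) (F : X × X → ℝ) (r : ℝ) : Prop :=
  ∃ t : ℝ, 0 ≤ t ∧ ∃ f g : C(X, ℝ), (∀ x y, F (x, y) ≤ f x + g y + t * dist x y) ∧
    ∫ x, f x ∂μ + ∫ x, g x ∂ν + t * K ≤ r

theorem IsMajorantBound.smul {μ ν : Measure X} {K : ℝ} {F : X × X → ℝ} {r c : ℝ} (hF : IsMajorantBound μ ν K F r)
    (hc : 0 ≤ c) : IsMajorantBound μ ν K (c • F) (c * r) := by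
  obtain ⟨t, ht, f, g, h1, h2⟩ := hF
  refine ⟨c * t, by positivity, c • f, c • g, fun x y => ?_, ?_⟩
  · have := mul_le_mul_of_nonneg_left (h1 x y) hc
    simp only [Pi.smul_apply, ContinuousMap.smul_apply, smul_eq_mul]
    linarith
  · have := mul_le_mul_of_nonneg_left h2 hc
    simp only [ContinuousMap.smul_apply, smul_eq_mul, integral_const_mul]
    linarith

variable [BorelSpace X]

theorem BoundedContinuousFunction.continuous_integral (μ : Measure X) [IsProbabilityMeasure μ] :
    Continuous fun f : X →ᵇ ℝ => ∫ x, f x ∂μ := by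
  refine (LipschitzWith.of_dist_le_mul (K := 1) fun f g => ?_).continuous
  rw [dist_eq_norm, ← integral_sub (f.integrable μ) (g.integrable μ)]
  refine (norm_integral_le_of_norm_le_const (C := dist f g) (ae_of_all _ fun x => ?_)).trans
    (by simp)
  rw [← dist_eq_norm]
  exact BoundedContinuousFunction.dist_coe_le_dist x

variable [CompactSpace X]

theorem ContinuousMap.integrable_of_compactSpace (μ : Measure X) [IsProbabilityMeasure μ]
    (f : C(X, ℝ)) : Integrable f μ :=
  (BoundedContinuousFunction.mkOfCompact f).integrable μ

/-- Replacing the first function of an admissible pair by its `c`-transform. -/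
theorem integral_add_integral_le_of_add_le_dist {μ ν : Measure X} [IsProbabilityMeasure μ]
    [IsProbabilityMeasure ν] {K : ℝ}
    (hK : ∀ u : X → ℝ, LipschitzWith 1 u → ∫ x, u x ∂μ - ∫ x, u x ∂ν ≤ K)
    {f g : C(X, ℝ)} (h : ∀ x y, f x + g y ≤ dist x y) :
    ∫ x, f x ∂μ + ∫ x, g x ∂ν ≤ K := by
  have : Nonempty X := nonempty_of_isProbabilityMeasure μ
  -- `u` is the largest function with `u x + g y ≤ dist x y`, so `f ≤ u`; taking `y = x` gives `g ≤
  -- -u`.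
  let u : X → ℝ := fun x => ⨅ y, (dist x y - g y)
  have hbdd : ∀ x, BddBelow (range fun y => dist x y - g y) := fun x =>
    ⟨f x, by rintro _ ⟨y, rfl⟩; linarith [h x y]⟩
  have hu : LipschitzWith 1 u := by
    refine LipschitzWith.of_le_add fun x y => ?_
    rw [← sub_le_iff_le_add]
    refine le_ciInf fun z => ?_
    have h1 := ciInf_le (hbdd x) z
    have h2 := dist_triangle x y z
    change u x ≤ _ at h1
    linarith
  have hfu : ∀ x, f x ≤ u x := fun x => le_ciInf fun y => by linarith [h x y]
  have hgu : ∀ x, g x ≤ -u x := fun x => by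
    have h1 := ciInf_le (hbdd x) x
    change u x ≤ _ at h1
    rw [dist_self] at h1
    linarith
  let U : C(X, ℝ) := ⟨u, hu.continuous⟩
  have i1 : ∫ x, f x ∂μ ≤ ∫ x, u x ∂μ :=
    integral_mono (f.integrable_of_compactSpace μ) (U.integrable_of_compactSpace μ) hfu
  have i2 : ∫ x, g x ∂ν ≤ ∫ x, -u x ∂ν :=
    integral_mono (g.integrable_of_compactSpace ν) (U.integrable_of_compactSpace ν).neg hgu
  rw [integral_neg] at i2
  linarith [hK u hu]

theorem IsMajorantBound.add {μ ν : Measure X} [IsProbabilityMeasure μ]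
    [IsProbabilityMeasure ν] {K : ℝ} {F G : X × X → ℝ} {r s : ℝ} (hF : IsMajorantBound μ ν K F r)
    (hG : IsMajorantBound μ ν K G s) : IsMajorantBound μ ν K (F + G) (r + s) := by
  obtain ⟨t, ht, f, g, h1, h2⟩ := hF
  obtain ⟨t', ht', f', g', h1', h2'⟩ := hG
  refine ⟨t + t', add_nonneg ht ht', f + f', g + g', fun x y => ?_, ?_⟩
  · have := h1 x y
    have := h1' x y
    simp only [Pi.add_apply, ContinuousMap.add_apply]
    linarith
  · simp only [ContinuousMap.add_apply]
    rw [integral_add (f.integrable_of_compactSpace μ) (f'.integrable_of_compactSpace μ),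
      integral_add (g.integrable_of_compactSpace ν) (g'.integrable_of_compactSpace ν)]
    linarith

variable {μ ν : Measure X} [IsProbabilityMeasure μ] [IsProbabilityMeasure ν] {K : ℝ}

/-- This keeps the infimum of the majorant bounds finite. For `t > 0`, dividing by `-t` turns the
majorant into a pair admissible for the cost `dist`; for `t = 0` one integrates in each variable. -/
theorem IsMajorantBound.neg_le
    (hK : ∀ u : X → ℝ, LipschitzWith 1 u → ∫ x, u x ∂μ - ∫ x, u x ∂ν ≤ K)
    {F : X × X → ℝ} {r B : ℝ} (hF : IsMajorantBound μ ν K F r) (hB : ∀ p, -B ≤ F p) :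
    -B ≤ r := by
  obtain ⟨t, ht, f, g, h1, h2⟩ := hF
  refine le_trans ?_ h2
  have h3 : ∀ x y, -B ≤ f x + g y + t * dist x y := fun x y => (hB (x, y)).trans (h1 x y)
  rcases ht.eq_or_lt with rfl | ht
  · have h4 : ∀ x, -B - f x ≤ ∫ y, g y ∂ν := fun x => by
      have := integral_mono (integrable_const (-B - f x)) (g.integrable_of_compactSpace ν)
        fun y => by linarith [h3 x y]
      simpa using this
    have := integral_mono (((integrable_const (-B)).sub (f.integrable_of_compactSpace μ)))
      (integrable_const (∫ y, g y ∂ν)) h4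
    simp only [Pi.sub_apply] at this
    rw [integral_sub (integrable_const _) (f.integrable_of_compactSpace μ)] at this
    simp only [integral_const, probReal_univ, one_smul] at this
    linarith
  · have h4 := integral_add_integral_le_of_add_le_dist hK
      (f := (-t⁻¹) • (f + ContinuousMap.const X B)) (g := (-t⁻¹) • g) fun x y => by
        have h5 := h3 x y
        have h6 : t⁻¹ * (-(f x + g y + B)) ≤ t⁻¹ * (t * dist x y) :=
          mul_le_mul_of_nonneg_left (by linarith) (by positivity)
        rw [inv_mul_cancel_left₀ ht.ne'] at h6
        simp only [ContinuousMap.smul_apply, ContinuousMap.add_apply, ContinuousMap.const_apply,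
          smul_eq_mul]
        linarith
    simp only [ContinuousMap.smul_apply, ContinuousMap.add_apply, ContinuousMap.const_apply,
      smul_eq_mul, integral_const_mul] at h4
    rw [integral_add (f.integrable_of_compactSpace μ) (integrable_const _)] at h4
    simp only [integral_const, probReal_univ, one_smul] at h4
    have h5 := mul_le_mul_of_nonneg_left h4 ht.le
    have h6 : t * (-t⁻¹ * (∫ x, f x ∂μ + B) + -t⁻¹ * ∫ x, g x ∂ν) =
        -(∫ x, f x ∂μ + B) - ∫ x, g x ∂ν := by
      field_simp
      ring
    rw [h6] at h5
    linarith

/-- The hard half of the Kantorovich–Rubinstein duality on a compact metric space. -/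
theorem exists_coupling_integral_dist_le
    (hK : ∀ u : X → ℝ, LipschitzWith 1 u → ∫ x, u x ∂μ - ∫ x, u x ∂ν ≤ K) :
    ∃ γ : Measure (X × X), IsProbabilityMeasure γ ∧ γ.map Prod.fst = μ ∧ γ.map Prod.snd = ν ∧
      ∫ p, dist p.1 p.2 ∂γ ≤ K := by
  have : Nonempty X := nonempty_of_isProbabilityMeasure μ
  have hbd : ∀ F : C_c(X × X, ℝ), ∃ B, ∀ p, -B ≤ F p := fun F => by
    obtain ⟨p, hp⟩ := F.continuous.exists_forall_le_of_hasCompactSupport F.hasCompactSupport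
    exact ⟨-F p, fun q => by simpa using hp q⟩
  have hbdd : ∀ F : C_c(X × X, ℝ), BddBelow {r | IsMajorantBound μ ν K F r} := fun F => by
    obtain ⟨B, hB⟩ := hbd F
    exact ⟨-B, fun r hr => IsMajorantBound.neg_le hK hr hB⟩
  have hne : ∀ F : C_c(X × X, ℝ), {r | IsMajorantBound μ ν K F r}.Nonempty := fun F => by
    obtain ⟨B, hB⟩ := hbd (-F)
    refine ⟨_, 0, le_rfl, ContinuousMap.const X B, 0, fun x y => ?_, le_rfl⟩
    have := hB (x, y)
    simp only [CompactlySupportedContinuousMap.coe_neg, Pi.neg_apply, neg_le_neg_iff] at this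
    simpa using this
  -- `N` is sublinear; Hahn–Banach yields a linear functional below it, and Riesz–Markov turns that
  -- into `γ`.
  let N : C_c(X × X, ℝ) → ℝ := fun F => sInf {r | IsMajorantBound μ ν K F r}
  have hsmul : ∀ c : ℝ, 0 < c → ∀ F, N (c • F) ≤ c * N F := fun c hc F => by
    rw [mul_comm, ← div_le_iff₀ hc]
    refine le_csInf (hne F) fun r hr => ?_
    rw [div_le_iff₀ hc, mul_comm]
    exact csInf_le (hbdd _) (by simpa using IsMajorantBound.smul hr hc.le)
  obtain ⟨Λ, -, hΛ⟩ := exists_extension_of_le_sublinear (⊥ : C_c(X × X, ℝ) →ₗ.[ℝ] ℝ) N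
    (fun c hc F => (hsmul c hc F).antisymm (by
      have := hsmul c⁻¹ (inv_pos.2 hc) (c • F)
      rw [smul_smul, inv_mul_cancel₀ hc.ne', one_smul] at this
      have h2 := mul_le_mul_of_nonneg_left this hc.le
      rwa [mul_inv_cancel_left₀ hc.ne'] at h2))
    (fun F G => by
      rw [← sub_le_iff_le_add]
      refine le_csInf (hne F) fun r hr => ?_
      rw [sub_le_iff_le_add, ← sub_le_iff_le_add']
      refine le_csInf (hne G) fun s hs => ?_
      rw [sub_le_iff_le_add']
      exact csInf_le (hbdd _) (by simpa using IsMajorantBound.add hr hs))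
    (by
      rintro ⟨F, hF⟩
      have hF0 : F = 0 := (Submodule.mem_bot ℝ).1 hF
      subst hF0
      have h0 : (⊥ : C_c(X × X, ℝ) →ₗ.[ℝ] ℝ) ⟨0, hF⟩ = 0 := LinearPMap.map_zero _
      rw [h0]
      refine le_csInf (hne _) fun r hr => ?_
      simpa using IsMajorantBound.neg_le hK hr (B := 0) (by simp))
  have hΛle : ∀ (F : C_c(X × X, ℝ)) r, IsMajorantBound μ ν K F r → Λ F ≤ r := fun F r hr =>
    (hΛ F).trans (csInf_le (hbdd F) hr)
  -- For `F ≥ 0` the zero majorant of `-F` gives positivity.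
  let Λp : C_c(X × X, ℝ) →ₚ[ℝ] ℝ := PositiveLinearMap.mk₀ Λ fun F hF => by
    have : Λ (-F) ≤ 0 := hΛle _ _ ⟨0, le_rfl, 0, 0, fun x y => by
      simpa using hF (x, y), by simp⟩
    rw [map_neg] at this
    linarith
  let γ := RealRMK.rieszMeasure Λp
  have hint : ∀ F : C_c(X × X, ℝ), ∫ p, F p ∂γ = Λ F := RealRMK.integral_rieszMeasure Λp
  have hfst : γ.map Prod.fst = μ := by
    refine ext_of_forall_integral_eq_of_IsFiniteMeasure fun f => ?_
    rw [integral_map (by fun_prop) f.continuous.aestronglyMeasurable]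
    let F : C_c(X × X, ℝ) := CompactlySupportedContinuousMap.continuousMapEquiv
      (f.toContinuousMap.comp ⟨Prod.fst, continuous_fst⟩)
    have h1 : ∫ p : X × X, f p.1 ∂γ = Λ F := hint F
    -- A function of one variable majorises itself, and so does its negative: the marginal is forced
    -- from both sides.
    have h2 : Λ F ≤ ∫ x, f x ∂μ := hΛle _ _
      ⟨0, le_rfl, f.toContinuousMap, 0, fun x y => by simp [F], by simp⟩
    have h3 : Λ (-F) ≤ -∫ x, f x ∂μ := hΛle _ _
      ⟨0, le_rfl, -f.toContinuousMap, 0, fun x y => by simp [F], by simp [integral_neg]⟩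
    rw [map_neg] at h3
    linarith
  have hsnd : γ.map Prod.snd = ν := by
    refine ext_of_forall_integral_eq_of_IsFiniteMeasure fun f => ?_
    rw [integral_map (by fun_prop) f.continuous.aestronglyMeasurable]
    let F : C_c(X × X, ℝ) := CompactlySupportedContinuousMap.continuousMapEquiv
      (f.toContinuousMap.comp ⟨Prod.snd, continuous_snd⟩)
    have h1 : ∫ p : X × X, f p.2 ∂γ = Λ F := hint F
    have h2 : Λ F ≤ ∫ x, f x ∂ν := hΛle _ _
      ⟨0, le_rfl, 0, f.toContinuousMap, fun x y => by simp [F], by simp⟩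
    have h3 : Λ (-F) ≤ -∫ x, f x ∂ν := hΛle _ _
      ⟨0, le_rfl, 0, -f.toContinuousMap, fun x y => by simp [F], by simp [integral_neg]⟩
    rw [map_neg] at h3
    linarith
  refine ⟨γ, ?_, hfst, hsnd, ?_⟩
  · rw [← hfst] at ‹IsProbabilityMeasure μ›
    exact Measure.isProbabilityMeasure_of_map Prod.fst
  · let F : C_c(X × X, ℝ) := CompactlySupportedContinuousMap.continuousMapEquiv
      ⟨fun p : X × X => dist p.1 p.2, continuous_dist⟩
    have h1 : ∫ p : X × X, dist p.1 p.2 ∂γ = Λ F := hint F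
    rw [h1]
    exact hΛle _ _ ⟨1, zero_le_one, 0, 0, fun x y => by simp [F], by simp⟩

-- Adding a constant does not change the dual value, so one may require `u x₀ = 0`; Arzelà–Ascoli
-- then makes the admissible set compact.
variable (μ ν) in
theorem exists_lipschitzWith_forall_integral_sub_le :
    ∃ u : X → ℝ, LipschitzWith 1 u ∧ ∀ v : X → ℝ, LipschitzWith 1 v →
      ∫ x, v x ∂μ - ∫ x, v x ∂ν ≤ ∫ x, u x ∂μ - ∫ x, u x ∂ν := by
  obtain ⟨x₀⟩ : Nonempty X := nonempty_of_isProbabilityMeasure μ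
  let A : Set (X →ᵇ ℝ) := {f | LipschitzWith 1 f ∧ f x₀ = 0}
  have hA : IsClosed A := by
    refine IsClosed.inter (?_ : IsClosed {f : X →ᵇ ℝ | LipschitzWith 1 f})
      (isClosed_singleton.preimage (continuous_eval_const x₀))
    simp only [lipschitzWith_iff_dist_le_mul, ofPred_forall]
    refine isClosed_iInter fun x => isClosed_iInter fun y => isClosed_le ?_ continuous_const
    exact (continuous_eval_const x).dist
      (continuous_eval_const y)
  have hAc : IsCompact A := by
    refine BoundedContinuousFunction.arzela_ascoli₂ (Metric.closedBall 0 (Metric.diam (univ : Set X)))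
      (isCompact_closedBall _ _) A hA (fun f x hf => ?_) ?_
    · rw [Metric.mem_closedBall, ← hf.2]
      refine (hf.1.dist_le_mul x x₀).trans ?_
      rw [NNReal.coe_one, one_mul]
      exact Metric.dist_le_diam_of_mem isCompact_univ.isBounded (mem_univ _) (mem_univ _)
    · exact (LipschitzWith.uniformEquicontinuous _ 1 fun f : A => f.2.1).equicontinuous
  have hcont : Continuous fun f : X →ᵇ ℝ => ∫ x, f x ∂μ - ∫ x, f x ∂ν :=
    (BoundedContinuousFunction.continuous_integral μ).sub
      (BoundedContinuousFunction.continuous_integral ν)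
  obtain ⟨u, huA, hu⟩ := hAc.exists_isMaxOn
    ⟨0, LipschitzWith.of_dist_le_mul fun x y => by simp, rfl⟩ hcont.continuousOn
  refine ⟨u, huA.1, fun v hv => ?_⟩
  have hv' : LipschitzWith 1 fun x => v x - v x₀ := by
    refine LipschitzWith.of_dist_le_mul fun x y => ?_
    rw [dist_sub_right]
    exact hv.dist_le_mul x y
  have hle := hu (show BoundedContinuousFunction.mkOfCompact ⟨_, hv'.continuous⟩ ∈ A from
    ⟨hv', by simp⟩)
  simp only [mem_ofPred_eq, BoundedContinuousFunction.mkOfCompact_apply, ContinuousMap.coe_mk]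
    at hle
  have iμ := ContinuousMap.integrable_of_compactSpace μ ⟨v, hv.continuous⟩
  have iν := ContinuousMap.integrable_of_compactSpace ν ⟨v, hv.continuous⟩
  simp only [ContinuousMap.coe_mk] at iμ iν
  rw [integral_sub iμ (integrable_const _), integral_sub iν (integrable_const _)] at hle
  simpa using hle

end Duality

/-! ### Couplings, their graphs and their cost -/

/-- A measure on a product that is concentrated on the graph of some function is concentrated on
the graph of a measurable function. -/
theorem exists_measurable_ae_eq_of_ae_eq {α E : Type*} [MeasurableSpace α]
    [NormedAddCommGroup E] [NormedSpace ℝ E] [CompleteSpace E] [SecondCountableTopology E]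
    [MeasurableSpace E] [BorelSpace E] {γ : Measure (α × E)} [IsFiniteMeasure γ] {S : α → E}
    (hS : ∀ᵐ p ∂γ, p.2 = S p.1) : ∃ T : α → E, Measurable T ∧ ∀ᵐ p ∂γ, p.2 = T p.1 := by
  have : Nonempty E := ⟨0⟩
  have h1 : ∀ᵐ p ∂(γ.fst.compProd γ.condKernel), p.2 = S p.1 := by
    rwa [Measure.disintegrate]
  have h2 := Measure.ae_ae_of_ae_compProd h1
  -- `S` need not be measurable; the conditional barycentre is, and it equals `S x` wherever the
  -- conditional law is concentrated at `S x`.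
  refine ⟨fun x => ∫ y, y ∂γ.condKernel x,
    (stronglyMeasurable_id.integral_kernel (κ := γ.condKernel)).measurable, ?_⟩
  have h3 : ∀ᵐ x ∂γ.fst, ∫ y, y ∂γ.condKernel x = S x := by
    filter_upwards [h2] with x hx
    rw [integral_congr_ae hx]
    simp
  filter_upwards [hS, ae_of_ae_map measurable_fst.aemeasurable h3] with p hp hp'
  rw [hp, ← hp']

theorem isProbabilityMeasure_comap_subtype_val {E : Type*} [NormedAddCommGroup E]
    [MeasurableSpace E] [BorelSpace E] {Ω : Set E} {μ : Measure E} [IsProbabilityMeasure μ]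
    (hΩ : IsCompact Ω) (hμΩ : μ Ωᶜ = 0) :
    IsProbabilityMeasure (μ.comap ((↑) : Ω → E)) := by
  have h : (μ.comap ((↑) : Ω → E)).map Subtype.val = μ := by
    rw [map_comap_subtype_coe hΩ.measurableSet,
      Measure.restrict_eq_self_of_ae_mem (mem_ae_iff.2 hμΩ)]
  have : IsProbabilityMeasure ((μ.comap ((↑) : Ω → E)).map Subtype.val) := by rwa [h]
  exact Measure.isProbabilityMeasure_of_map ((↑) : Ω → E)

theorem Continuous.integrable_of_measure_compl_eq_zero {E F : Type*}
    [NormedAddCommGroup E] [MeasurableSpace E] [BorelSpace E] {Ω : Set E} {μ : Measure E}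
    [NormedAddCommGroup F]
    [SecondCountableTopology F] {f : E → F} (hf : Continuous f) [IsFiniteMeasure μ]
    (hΩ : IsCompact Ω) (hμΩ : μ Ωᶜ = 0) : Integrable f μ := by
  have := hf.continuousOn.integrableOn_compact (μ := μ) hΩ
  rwa [IntegrableOn, Measure.restrict_eq_self_of_ae_mem (mem_ae_iff.2 hμΩ)] at this

section Coupling

variable {E : Type*} [NormedAddCommGroup E] [SecondCountableTopology E] [MeasurableSpace E]
  [BorelSpace E] {Ω : Set E} {μ ν : Measure E}

variable [IsProbabilityMeasure μ] [IsProbabilityMeasure ν] {γ : Measure (E × E)}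

theorem integrable_norm_sub_of_coupling (hΩ : IsCompact Ω)
    (hμΩ : μ Ωᶜ = 0) (hνΩ : ν Ωᶜ = 0) (h1 : γ.map Prod.fst = μ) (h2 : γ.map Prod.snd = ν) :
    Integrable (fun p : E × E => ‖p.1 - p.2‖) γ := by
  have i1 : Integrable id (γ.map Prod.fst) := by
    rw [h1]; exact continuous_id.integrable_of_measure_compl_eq_zero hΩ hμΩ
  have i2 : Integrable id (γ.map Prod.snd) := by
    rw [h2]; exact continuous_id.integrable_of_measure_compl_eq_zero hΩ hνΩ
  exact ((i1.comp_measurable measurable_fst).sub (i2.comp_measurable measurable_snd)).norm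

/-- The easy half of the duality, with the case of equality. -/
theorem LipschitzOnWith.integral_sub_le_integral_norm_sub {u : E → ℝ} (hu : LipschitzOnWith 1 u Ω)
    (hΩ : IsCompact Ω) (hμΩ : μ Ωᶜ = 0) (hνΩ : ν Ωᶜ = 0) (h1 : γ.map Prod.fst = μ)
    (h2 : γ.map Prod.snd = ν) :
    (∫ x in Ω, u x ∂μ) - ∫ y in Ω, u y ∂ν ≤ ∫ p, ‖p.1 - p.2‖ ∂γ ∧
      (∫ p, ‖p.1 - p.2‖ ∂γ ≤ (∫ x in Ω, u x ∂μ) - ∫ y in Ω, u y ∂ν →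
        ∀ᵐ p ∂γ, p.1 ∈ Ω ∧ p.2 ∈ Ω ∧ u p.1 - u p.2 = ‖p.1 - p.2‖) := by
  -- `u` is arbitrary off `Ω`; a global Lipschitz extension restores continuity.
  obtain ⟨v, hv, huv⟩ := hu.extend_real
  have hvle : ∀ x y, v x - v y ≤ ‖x - y‖ := fun x y =>
    hv.lipschitzOnWith.sub_le_norm_sub (Ω := univ) (mem_univ x) (mem_univ y)
  have eμ : ∫ x in Ω, u x ∂μ = ∫ p, v p.1 ∂γ := by
    rw [setIntegral_congr_fun hΩ.measurableSet huv,
      Measure.restrict_eq_self_of_ae_mem (mem_ae_iff.2 hμΩ), ← h1,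
      integral_map measurable_fst.aemeasurable hv.continuous.aestronglyMeasurable]
  have eν : ∫ x in Ω, u x ∂ν = ∫ p, v p.2 ∂γ := by
    rw [setIntegral_congr_fun hΩ.measurableSet huv,
      Measure.restrict_eq_self_of_ae_mem (mem_ae_iff.2 hνΩ), ← h2,
      integral_map measurable_snd.aemeasurable hv.continuous.aestronglyMeasurable]
  have i1 : Integrable (fun p : E × E => v p.1) γ := by
    have : Integrable v (γ.map Prod.fst) := by
      rw [h1]; exact hv.continuous.integrable_of_measure_compl_eq_zero hΩ hμΩ
    exact this.comp_measurable measurable_fst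
  have i2 : Integrable (fun p : E × E => v p.2) γ := by
    have : Integrable v (γ.map Prod.snd) := by
      rw [h2]; exact hv.continuous.integrable_of_measure_compl_eq_zero hΩ hνΩ
    exact this.comp_measurable measurable_snd
  have i3 := integrable_norm_sub_of_coupling hΩ hμΩ hνΩ h1 h2
  rw [eμ, eν, ← integral_sub i1 i2]
  refine ⟨integral_mono (i1.sub i2) i3 fun p => hvle _ _, fun hle => ?_⟩
  -- The slack is nonnegative with zero integral, so it vanishes almost everywhere.
  have hz : ∫ p, (‖p.1 - p.2‖ - (v p.1 - v p.2)) ∂γ = 0 := by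
    refine le_antisymm ?_ (integral_nonneg fun p => sub_nonneg.2 (hvle _ _))
    rw [integral_sub i3 (show Integrable (fun p : E × E => v p.1 - v p.2) γ from i1.sub i2)]
    exact sub_nonpos.2 hle
  rw [integral_eq_zero_iff_of_nonneg (fun p => sub_nonneg.2 (hvle _ _)) (i3.sub (i1.sub i2))] at hz
  have m1 : ∀ᵐ p ∂γ, p.1 ∈ Ω := ae_of_ae_map measurable_fst.aemeasurable
    (by rw [h1]; exact mem_ae_iff.2 hμΩ)
  have m2 : ∀ᵐ p ∂γ, p.2 ∈ Ω := ae_of_ae_map measurable_snd.aemeasurable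
    (by rw [h2]; exact mem_ae_iff.2 hνΩ)
  filter_upwards [hz, m1, m2] with p hp hp1 hp2
  refine ⟨hp1, hp2, ?_⟩
  rw [huv hp1, huv hp2]
  exact (sub_eq_zero.1 hp).symm

end Coupling

theorem exists_isKantorovichPotential {d : ℕ} {Ω : Set (EuclideanSpace ℝ (Fin d))}
    (hΩ : IsCompact Ω) {μ ν : Measure (EuclideanSpace ℝ (Fin d))} [IsProbabilityMeasure μ]
    [IsProbabilityMeasure ν] (hμΩ : μ Ωᶜ = 0) (hνΩ : ν Ωᶜ = 0) :
    ∃ u, IsKantorovichPotential Ω μ ν u := by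
  have := isCompact_iff_compactSpace.1 hΩ
  have := isProbabilityMeasure_comap_subtype_val hΩ hμΩ
  have := isProbabilityMeasure_comap_subtype_val hΩ hνΩ
  obtain ⟨w, hw, hmax⟩ := exists_lipschitzWith_forall_integral_sub_le
    (μ.comap ((↑) : Ω → EuclideanSpace ℝ (Fin d))) (ν.comap ((↑) : Ω → EuclideanSpace ℝ (Fin d)))
  let u := Function.extend ((↑) : Ω → EuclideanSpace ℝ (Fin d)) w 0
  have huw : ∀ x : Ω, u x = w x := fun x => Subtype.val_injective.extend_apply w 0 x
  refine ⟨u, ?_, fun v hv => ?_⟩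
  · rw [lipschitzOnWith_iff_restrict]
    exact (funext huw : Ω.domRestrict u = w) ▸ hw
  · have := hmax (Ω.domRestrict v) (lipschitzOnWith_iff_restrict.1 hv)
    simp only [← huw, domRestrict_apply] at this
    simpa only [integral_subtype_comap hΩ.measurableSet] using this

theorem IsKantorovichPotential.exists_coupling {d : ℕ} {Ω : Set (EuclideanSpace ℝ (Fin d))}
    (hΩ : IsCompact Ω) {μ ν : Measure (EuclideanSpace ℝ (Fin d))} [IsProbabilityMeasure μ]
    [IsProbabilityMeasure ν] (hμΩ : μ Ωᶜ = 0) (hνΩ : ν Ωᶜ = 0)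
    {u : EuclideanSpace ℝ (Fin d) → ℝ} (hu : IsKantorovichPotential Ω μ ν u) :
    ∃ γ : Measure (EuclideanSpace ℝ (Fin d) × EuclideanSpace ℝ (Fin d)),
      IsProbabilityMeasure γ ∧ γ.map Prod.fst = μ ∧ γ.map Prod.snd = ν ∧
      ∫ p, ‖p.1 - p.2‖ ∂γ ≤ (∫ x in Ω, u x ∂μ) - ∫ y in Ω, u y ∂ν := by
  have := isCompact_iff_compactSpace.1 hΩ
  have := isProbabilityMeasure_comap_subtype_val hΩ hμΩ
  have := isProbabilityMeasure_comap_subtype_val hΩ hνΩ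
  obtain ⟨γ, hγ, h1, h2, h3⟩ := exists_coupling_integral_dist_le
    (μ := μ.comap ((↑) : Ω → EuclideanSpace ℝ (Fin d)))
    (ν := ν.comap ((↑) : Ω → EuclideanSpace ℝ (Fin d)))
    (K := (∫ x in Ω, u x ∂μ) - ∫ y in Ω, u y ∂ν) fun w hw => by
      let v := Function.extend ((↑) : Ω → EuclideanSpace ℝ (Fin d)) w 0
      have hvw : ∀ x : Ω, v x = w x := fun x => Subtype.val_injective.extend_apply w 0 x
      have := hu.2 v (by
        rw [lipschitzOnWith_iff_restrict]
        exact (funext hvw : Ω.domRestrict v = w) ▸ hw)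
      simpa only [← integral_subtype_comap hΩ.measurableSet, hvw] using this
  have hmeas : Measurable (Prod.map ((↑) : Ω → EuclideanSpace ℝ (Fin d))
    ((↑) : Ω → EuclideanSpace ℝ (Fin d))) := measurable_subtype_coe.prodMap measurable_subtype_coe
  refine ⟨γ.map (Prod.map (↑) (↑)), Measure.isProbabilityMeasure_map hmeas.aemeasurable,
    ?_, ?_, ?_⟩
  · rw [Measure.map_map measurable_fst hmeas,
      show Prod.fst ∘ Prod.map Subtype.val Subtype.val = Subtype.val ∘ Prod.fst from rfl,
      ← Measure.map_map measurable_subtype_coe measurable_fst, h1,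
      map_comap_subtype_coe hΩ.measurableSet,
      Measure.restrict_eq_self_of_ae_mem (mem_ae_iff.2 hμΩ)]
  · rw [Measure.map_map measurable_snd hmeas,
      show Prod.snd ∘ Prod.map Subtype.val Subtype.val = Subtype.val ∘ Prod.snd from rfl,
      ← Measure.map_map measurable_subtype_coe measurable_snd, h2,
      map_comap_subtype_coe hΩ.measurableSet,
      Measure.restrict_eq_self_of_ae_mem (mem_ae_iff.2 hνΩ)]
  · rw [integral_map hmeas.aemeasurable (by fun_prop)]
    simpa only [Subtype.dist_eq, dist_eq_norm, Prod.map_fst, Prod.map_snd] using h3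

/-! ### Transport maps and the conclusion -/

section Maps

variable {d : ℕ} {Ω : Set (EuclideanSpace ℝ (Fin d))} {μ ν : Measure (EuclideanSpace ℝ (Fin d))}
  {T : EuclideanSpace ℝ (Fin d) → EuclideanSpace ℝ (Fin d)}

theorem MeasureTheory.MeasurePreserving.map_graph_fst (hT : MeasurePreserving T μ ν) :
    (μ.map fun x => (x, T x)).map Prod.fst = μ := by
  rw [Measure.map_map measurable_fst (measurable_id'.prodMk hT.measurable)]
  exact Measure.map_id

theorem MeasureTheory.MeasurePreserving.map_graph_snd (hT : MeasurePreserving T μ ν) :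
    (μ.map fun x => (x, T x)).map Prod.snd = ν := by
  rw [Measure.map_map measurable_snd (measurable_id'.prodMk hT.measurable)]
  exact hT.map_eq

theorem MeasureTheory.MeasurePreserving.integral_map_graph (hT : MeasurePreserving T μ ν) :
    ∫ p, ‖p.1 - p.2‖ ∂(μ.map fun x => (x, T x)) = ∫ x, ‖x - T x‖ ∂μ :=
  integral_map (measurable_id.prodMk hT.measurable).aemeasurable (by fun_prop)

theorem transportCost_eq_ofReal [IsProbabilityMeasure μ] [IsProbabilityMeasure ν]
    (hT : MeasurePreserving T μ ν) (hΩ : IsCompact Ω) (hμΩ : μ Ωᶜ = 0) (hνΩ : ν Ωᶜ = 0) :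
    transportCost Ω μ T = ENNReal.ofReal (∫ x, ‖x - T x‖ ∂μ) := by
  rw [transportCost, Measure.restrict_eq_self_of_ae_mem (mem_ae_iff.2 hμΩ),
    ofReal_integral_eq_lintegral_ofReal _ (ae_of_all _ fun x => norm_nonneg _)]
  exact (integrable_norm_sub_of_coupling hΩ hμΩ hνΩ hT.map_graph_fst
    hT.map_graph_snd).comp_measurable (measurable_id.prodMk hT.measurable)

end Maps

/-- An optimal coupling is concentrated on the graph of the map that sends each point to the lower
end of its transport ray. -/
theorem LipschitzOnWith.ae_eq_ray_end_of_coupling {d m : ℕ} (hm : m + 2 ≤ d)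
    {Ω : Set (EuclideanSpace ℝ (Fin d))} (hΩ : IsCompact Ω) (hΩ' : Convex ℝ Ω)
    {μ ν : Measure (EuclideanSpace ℝ (Fin d))} [IsProbabilityMeasure μ] [IsProbabilityMeasure ν]
    (hμΩ : μ Ωᶜ = 0) (hνΩ : ν Ωᶜ = 0) (hμ : μ ≪ volume)
    {M : Set (EuclideanSpace ℝ (Fin d))} (hM : IsC1Submanifold m M) (hν : ν.support ⊆ M)
    {u : EuclideanSpace ℝ (Fin d) → ℝ} (hu : LipschitzOnWith 1 u Ω)
    {γ : Measure (EuclideanSpace ℝ (Fin d) × EuclideanSpace ℝ (Fin d))}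
    (h1 : γ.map Prod.fst = μ) (h2 : γ.map Prod.snd = ν)
    (hγ : ∫ p, ‖p.1 - p.2‖ ∂γ ≤ (∫ x in Ω, u x ∂μ) - ∫ y in Ω, u y ∂ν) :
    ∀ᵐ p ∂γ, DifferentiableAt ℝ u p.1 ∧ p.2 = p.1 - rayLength Ω u p.1 • ∇ u p.1 := by
  have hray := hμ.ae_le (hu.ae_eq_ray_end hm hΩ hΩ' hM)
  have hsupp : ∀ᵐ y ∂ν, y ∈ M := mem_of_superset ν.support_mem_ae hν
  rw [← h1] at hray
  rw [← h2] at hsupp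
  filter_upwards [(hu.integral_sub_le_integral_norm_sub hΩ hμΩ hνΩ h1 h2).2 hγ,
    ae_of_ae_map measurable_fst.aemeasurable hray,
    ae_of_ae_map measurable_snd.aemeasurable hsupp] with p ⟨hp1, hp2, hp⟩ hr hs
  exact ⟨(hr hp1).1, (hr hp1).2 p.2 ⟨hp2, hs⟩ hp⟩

theorem theorem1 {d m : ℕ} (hm : m + 2 ≤ d)
    (Ω : Set (EuclideanSpace ℝ (Fin d))) (hΩ : IsCompact Ω) (hΩ' : Convex ℝ Ω)
    (μ ν : Measure (EuclideanSpace ℝ (Fin d))) [IsProbabilityMeasure μ] [IsProbabilityMeasure ν]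
    (hμΩ : μ Ωᶜ = 0) (hνΩ : ν Ωᶜ = 0) (hμ : μ ≪ volume)
    (M : Set (EuclideanSpace ℝ (Fin d))) (hM : IsC1Submanifold m M) (hν : ν.support ⊆ M) :
    (∃ T₀, IsOptimalTransportMap Ω μ ν T₀) ∧
    (∀ T₀ T₁, IsOptimalTransportMap Ω μ ν T₀ → IsOptimalTransportMap Ω μ ν T₁ → T₀ =ᵐ[μ] T₁) ∧
    (∃ u₀, IsKantorovichPotential Ω μ ν u₀) ∧
    (∀ u₀ T₀, IsKantorovichPotential Ω μ ν u₀ → IsOptimalTransportMap Ω μ ν T₀ →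
      ∀ᵐ x ∂μ, DifferentiableAt ℝ u₀ x ∧ T₀ x = x - rayLength Ω u₀ x • ∇ u₀ x) := by
  obtain ⟨u, hu⟩ := exists_isKantorovichPotential hΩ hμΩ hνΩ
  obtain ⟨γ, hγ, h1, h2, h3⟩ := hu.exists_coupling hΩ hμΩ hνΩ
  obtain ⟨T, hTm, hT⟩ := exists_measurable_ae_eq_of_ae_eq
    (S := fun x => x - rayLength Ω u x • ∇ u x)
    ((hu.1.ae_eq_ray_end_of_coupling hm hΩ hΩ' hμΩ hνΩ hμ hM hν h1 h2 h3).mono fun p hp => hp.2)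
  have hTmp : MeasurePreserving T μ ν := by
    refine ⟨hTm, ?_⟩
    rw [← h1, Measure.map_map hTm measurable_fst, ← h2]
    exact Measure.map_congr (hT.mono fun p hp => hp.symm)
  have hTcost : ∫ x, ‖x - T x‖ ∂μ ≤ (∫ x in Ω, u x ∂μ) - ∫ y in Ω, u y ∂ν := by
    rw [← h1, integral_map measurable_fst.aemeasurable
      (by have := hTm; fun_prop), h1]
    refine le_of_eq_of_le (integral_congr_ae ?_) h3
    filter_upwards [hT] with p hp
    rw [hp]
  have hle : ∀ S, MeasurePreserving S μ ν →
      ENNReal.ofReal ((∫ x in Ω, u x ∂μ) - ∫ y in Ω, u y ∂ν) ≤ transportCost Ω μ S := by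
    intro S hS
    rw [transportCost_eq_ofReal hS hΩ hμΩ hνΩ, ← hS.integral_map_graph]
    exact ENNReal.ofReal_le_ofReal (hu.1.integral_sub_le_integral_norm_sub hΩ hμΩ hνΩ
      hS.map_graph_fst hS.map_graph_snd).1
  have hTle : transportCost Ω μ T ≤ ENNReal.ofReal ((∫ x in Ω, u x ∂μ) - ∫ y in Ω, u y ∂ν) := by
    rw [transportCost_eq_ofReal hTmp hΩ hμΩ hνΩ]
    exact ENNReal.ofReal_le_ofReal hTcost
  -- The map attains the dual value, a lower bound for every cost, so the infimum over maps equals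
  -- it.
  have hW : W1 Ω μ ν = ENNReal.ofReal ((∫ x in Ω, u x ∂μ) - ∫ y in Ω, u y ∂ν) :=
    le_antisymm ((iInf₂_le T hTmp).trans hTle) (le_iInf₂ hle)
  have hmain : ∀ u₀ T₀, IsKantorovichPotential Ω μ ν u₀ → IsOptimalTransportMap Ω μ ν T₀ →
      ∀ᵐ x ∂μ, DifferentiableAt ℝ u₀ x ∧ T₀ x = x - rayLength Ω u₀ x • ∇ u₀ x := by
    intro u₀ T₀ hu₀ hT₀
    have hcost := hT₀.2
    rw [hW, transportCost_eq_ofReal hT₀.1 hΩ hμΩ hνΩ] at hcost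
    have hnonneg : 0 ≤ (∫ x in Ω, u x ∂μ) - ∫ y in Ω, u y ∂ν := by
      simpa using hu.2 (fun _ => 0) (LipschitzWith.const' 0).lipschitzOnWith
    have hcost' := (ENNReal.ofReal_le_ofReal_iff hnonneg).1 hcost.le
    have hg := hu₀.1.ae_eq_ray_end_of_coupling hm hΩ hΩ' hμΩ hνΩ hμ hM hν hT₀.1.map_graph_fst
      hT₀.1.map_graph_snd (by
        rw [hT₀.1.integral_map_graph]
        -- `u₀` has at least the dual value of `u`, so the graph coupling of `T₀` is optimal for
        -- `u₀` as well.
        exact hcost'.trans (hu₀.2 u hu.1))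
    exact ae_of_ae_map (measurable_id.prodMk hT₀.1.measurable).aemeasurable hg
  refine ⟨⟨T, hTmp, hTle.antisymm (hle T hTmp) |>.trans hW.symm⟩, fun T₀ T₁ hT₀ hT₁ => ?_,
    ⟨u, hu⟩, hmain⟩
  -- Both maps are given by the formula for the same potential `u`.
  filter_upwards [hmain u T₀ hu hT₀, hmain u T₁ hu hT₁] with x hx₀ hx₁
  rw [hx₀.2, hx₁.2]
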